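/- Let $\mathcal H$ be a complex Hilbert space with inner product antilinear in the first argument. Call a densely defined operator $A$ on $\mathcal H$ accretive if $\mathrm{Re}\langle\psi,A\psi\rangle\ge 0$ for all $\psi\in\mathcal D(A)$, maximally accretive if it is accretive and has no non-trivial accretive extension, and sectorial if it is accretive and $e^{i\varphi}A$ is accretive as well for some $\varphi\in(0,2\pi)$. Let $S$ and $V$ be densely defined symmetric operators on $\mathcal H$ with $\mathcal D(S)=\mathcal D(V)$ and $V\ge\varepsilon$ for some $\varepsilon>0$, such that $A_\pm:=\pm iS+V$ (with domain $\mathcal D(S)=\mathcal D(V)$) are sectorial. Let $A_D$ be any maximally accretive operator with $A_+\subset A_D\subset A_-^*$ (a proper maximally accretive extension of the dual pair $(A_+,A_-)$), and let $\mathfrak{re}_{D,0}$ be the non-negative quadratic form $$\mathcal D(\mathfrak{re}_{D,0})=\mathcal D(A_D),\qquad \mathfrak{re}_{D,0}(\psi)=\mathrm{Re}\langle\psi,A_D\psi\rangle .$$ Assume that $\mathfrak{re}_{D,0}$ is closable, i.e. for every sequence $(f_n)$ in $\mathcal D(A_D)$ with $\|f_n\|\to0$ and $\mathfrak{re}_{D,0}(f_n-f_m)\to0$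 as $n,m\to\infty$ one has $\mathfrak{re}_{D,0}(f_n)\to0$. Let $\mathfrak{re}_D$ be its closure: $\mathcal D(\mathfrak{re}_D)$ consists of all $f\in\mathcal H$ for which there is a sequence $(f_n)$ in $\mathcal D(A_D)$ with $f_n\to f$ and $\mathfrak{re}_{D,0}(f_n-f_m)\to0$, and $\mathfrak{re}_D(f)=\lim_n\mathfrak{re}_{D,0}(f_n)$; write $\mathfrak{re}_D(\cdot,\cdot)$ for the sesquilinear form obtained by polarization. Let $V_D$ be the operator associated with $\mathfrak{re}_D$: $$\mathcal D(V_D)=\{f\in\mathcal D(\mathfrak{re}_D):\exists\, w\in\mathcal H\ \forall g\in\mathcal D(\mathfrak{re}_D):\ \mathfrak{re}_D(f,g)=\langle w,g\rangle\},\qquad V_Df=w .$$ Then $V_D$ is selfadjoint and non-negative, and it extends $V$, i.e. $V\subset V_D$. -/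

import Mathlib

open Filter Topology
open scoped ComplexConjugate

noncomputable section

namespace RealPartForm

variable {H : Type*} [NormedAddCommGroup H] [InnerProductSpace ℂ H]

/-! ### Unbounded operators

An operator on `H` is a linear map defined on a subspace of `H`, i.e. a term of `H →ₗ.[ℂ] H`;
`A ≤ B` means that `B` extends `A`. The inner product is antilinear in the first argument. -/

/-- Densely defined symmetric operators. -/
def IsSymmetricOp (T : H →ₗ.[ℂ] H) : Prop :=
  Dense (T.domain : Set H) ∧ T.IsFormalAdjoint T

/-- `T ≥ c` in the sense of `Re ⟨ψ, T ψ⟩ ≥ c ‖ψ‖²` for all `ψ` in the domain of `T`. -/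
def IsBoundedBelowBy (T : H →ₗ.[ℂ] H) (c : ℝ) : Prop :=
  ∀ ψ : T.domain, c * ‖(ψ : H)‖ ^ 2 ≤ (inner ℂ (ψ : H) (T ψ)).re

/-- Accretive operators: densely defined with `Re ⟨ψ, A ψ⟩ ≥ 0` on the domain. -/
def IsAccretive (A : H →ₗ.[ℂ] H) : Prop :=
  Dense (A.domain : Set H) ∧ ∀ ψ : A.domain, 0 ≤ (inner ℂ (ψ : H) (A ψ)).re

/-- Accretive operators without non-trivial accretive extension. -/
def IsMaximallyAccretive (A : H →ₗ.[ℂ] H) : Prop :=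
  IsAccretive A ∧ ∀ B : H →ₗ.[ℂ] H, IsAccretive B → A ≤ B → B = A

/-- Accretive operators `A` such that `e^{iφ} A` is accretive as well for some `φ ∈ (0, 2π)`. -/
def IsSectorial (A : H →ₗ.[ℂ] H) : Prop :=
  IsAccretive A ∧ ∃ φ ∈ Set.Ioo (0 : ℝ) (2 * Real.pi),
    IsAccretive (Complex.exp (φ * Complex.I) • A)

/-- `A_+ = i S + V`, with domain `D(S) ∩ D(V)`. -/
def opPlus (S V : H →ₗ.[ℂ] H) : H →ₗ.[ℂ] H := Complex.I • S + V

/-- `A_- = - i S + V`, with domain `D(S) ∩ D(V)`. -/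
def opMinus (S V : H →ₗ.[ℂ] H) : H →ₗ.[ℂ] H := (-Complex.I) • S + V

/-- `B` is a proper extension of the dual pair `(A, A')`, i.e. `A ⊂ B ⊂ A'^*`. -/
def IsProperExtension [CompleteSpace H] (A A' B : H →ₗ.[ℂ] H) : Prop :=
  A ≤ B ∧ B ≤ A'.adjoint

/-! ### Non-negative forms -/

variable (H) in
/-- A non-negative form with domain a subspace of `H`. The quadratic form is
`f ↦ q.form f f`, which is real; it is given together with the Hermitian sesquilinear form
that it determines by polarization. -/
structure NonnegForm where
  domain : Submodule ℂ H
  form : domain →ₗ⋆[ℂ] domain →ₗ[ℂ] ℂ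
  conj_symm : ∀ f g, conj (form g f) = form f g
  nonneg : ∀ f, 0 ≤ (form f f).re

namespace NonnegForm

/-- The value `q(f)` of the quadratic form. -/
def quad (q : NonnegForm H) (f : q.domain) : ℝ := (q.form f f).re

/-- `u n → f` in `H` and `q(u n - u m) → 0` as `n, m → ∞`. -/
def Approximates (q : NonnegForm H) (u : ℕ → q.domain) (f : H) : Prop :=
  Tendsto (fun n => (u n : H)) atTop (𝓝 f) ∧
    Tendsto (fun p : ℕ × ℕ => q.quad (u p.1 - u p.2)) atTop (𝓝 0)

/-- Closable forms: if `u n → 0` in `H` and `q(u n - u m) → 0`, then `q(u n) → 0`. -/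
def IsClosable (q : NonnegForm H) : Prop :=
  ∀ u : ℕ → q.domain, q.Approximates u 0 → Tendsto (fun n => q.quad (u n)) atTop (𝓝 0)

theorem norm_form_sq_le (q : NonnegForm H) (f g : q.domain) :
    ‖q.form f g‖ ^ 2 ≤ q.quad f * q.quad g := by
  let c : PreInnerProductSpace.Core ℂ q.domain :=
    { inner := fun f g => q.form f g
      conj_inner_symm := q.conj_symm
      re_inner_nonneg := q.nonneg
      add_left := fun x y z => by simp
      smul_left := fun x y r => by simp }
  have h := @InnerProductSpace.Core.inner_mul_inner_self_le ℂ q.domain _ _ _ c f g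
  have h1 : ‖q.form f g‖ * ‖q.form g f‖ ≤ q.quad f * q.quad g := h
  have h2 : ‖q.form g f‖ = ‖q.form f g‖ := by
    rw [← q.conj_symm f g, RCLike.norm_conj]
  rw [h2] at h1
  rwa [sq]

theorem quad_nonneg (q : NonnegForm H) (f : q.domain) : 0 ≤ q.quad f := q.nonneg f

theorem norm_form_le (q : NonnegForm H) (f g : q.domain) :
    ‖q.form f g‖ ≤ √(q.quad f) * √(q.quad g) := by
  rw [← Real.sqrt_mul (q.quad_nonneg f)]
  exact Real.le_sqrt_of_sq_le (q.norm_form_sq_le f g)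

theorem sqrt_quad_add_le (q : NonnegForm H) (f g : q.domain) :
    √(q.quad (f + g)) ≤ √(q.quad f) + √(q.quad g) := by
  apply Real.sqrt_le_iff.mpr
  refine ⟨by positivity, ?_⟩
  have e : q.quad (f + g) = q.quad f + q.quad g + ((q.form f g).re + (q.form g f).re) := by
    simp [quad]; ring
  have h1 := (Complex.re_le_norm _).trans (q.norm_form_le f g)
  have h2 := (Complex.re_le_norm _).trans (q.norm_form_le g f)
  have h3 := Real.sq_sqrt (q.quad_nonneg f)
  have h4 := Real.sq_sqrt (q.quad_nonneg g)
  rw [e]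
  nlinarith

theorem quad_smul (q : NonnegForm H) (c : ℂ) (f : q.domain) :
    q.quad (c • f) = ‖c‖ ^ 2 * q.quad f := by
  have : q.form (c • f) (c • f) = ((‖c‖ ^ 2 : ℝ) : ℂ) * q.form f f := by
    simp only [map_smulₛₗ, LinearMap.smul_apply, smul_eq_mul, RingHom.id_apply]
    rw [← mul_assoc, mul_comm c, Complex.conj_mul']
    push_cast
    rfl
  rw [quad, this, Complex.re_ofReal_mul, quad]

theorem quad_neg (q : NonnegForm H) (f : q.domain) : q.quad (-f) = q.quad f := by
  simp [quad]

theorem sqrt_quad_bounded {q : NonnegForm H} {u : ℕ → q.domain} {f : H}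
    (hu : q.Approximates u f) : ∃ C : ℝ, ∀ᶠ n in atTop, √(q.quad (u n)) ≤ C := by
  have h := hu.2.eventually (gt_mem_nhds (zero_lt_one))
  rw [eventually_atTop] at h
  obtain ⟨⟨a, b⟩, hab⟩ := h
  refine ⟨1 + √(q.quad (u b)), ?_⟩
  filter_upwards [eventually_ge_atTop a] with n hn
  have h1 := hab (n, b) ⟨hn, le_rfl⟩
  have h2 := q.sqrt_quad_add_le (u n - u b) (u b)
  rw [sub_add_cancel] at h2
  have h3 : √(q.quad (u n - u b)) ≤ 1 := Real.sqrt_le_one.mpr h1.le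
  linarith

theorem tendsto_quad_diff {q : NonnegForm H} (hq : q.IsClosable) {u u' : ℕ → q.domain} {f : H}
    (hu : q.Approximates u f) (hu' : q.Approximates u' f) :
    Tendsto (fun n => √(q.quad (u n - u' n))) atTop (𝓝 0) := by
  have key : q.Approximates (fun n => u n - u' n) 0 := by
    refine ⟨by simpa using hu.1.sub hu'.1, ?_⟩
    have h := (hu.2.sqrt).add (hu'.2.sqrt)
    simp only [Real.sqrt_zero, add_zero] at h
    have h2 := h.pow 2
    rw [zero_pow two_ne_zero] at h2
    refine squeeze_zero (fun _ => q.quad_nonneg _) (fun p => ?_) h2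
    have h3 := q.sqrt_quad_add_le (u p.1 - u p.2) (-(u' p.1 - u' p.2))
    rw [quad_neg] at h3
    have e : u p.1 - u p.2 + -(u' p.1 - u' p.2) = u p.1 - u' p.1 - (u p.2 - u' p.2) := by abel
    rw [e] at h3
    exact (Real.sqrt_le_left (by positivity)).mp h3
  simpa using (hq _ key).sqrt

theorem tendsto_form_zero {ι : Type*} {l : Filter ι} {q : NonnegForm H} {u v : ι → q.domain}
    (hu : Tendsto (fun n => √(q.quad (u n))) l (𝓝 0))
    (hv : ∃ C : ℝ, ∀ᶠ n in l, √(q.quad (v n)) ≤ C) :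
    Tendsto (fun n => q.form (u n) (v n)) l (𝓝 0) ∧
      Tendsto (fun n => q.form (v n) (u n)) l (𝓝 0) := by
  obtain ⟨C, hC⟩ := hv
  have h0 : Tendsto (fun n => √(q.quad (u n)) * C) l (𝓝 0) := by
    simpa using hu.mul_const C
  constructor
  · refine squeeze_zero_norm' ?_ h0
    filter_upwards [hC] with n hn
    exact (q.norm_form_le _ _).trans (mul_le_mul_of_nonneg_left hn (Real.sqrt_nonneg _))
  · refine squeeze_zero_norm' ?_ h0
    filter_upwards [hC] with n hn
    refine (q.norm_form_le _ _).trans ?_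
    rw [mul_comm]
    exact mul_le_mul_of_nonneg_left hn (Real.sqrt_nonneg _)

theorem cauchySeq_form {q : NonnegForm H} {u v : ℕ → q.domain} {f g : H}
    (hu : q.Approximates u f) (hv : q.Approximates v g) :
    CauchySeq (fun n => q.form (u n) (v n)) := by
  rw [cauchySeq_iff_tendsto_dist_atTop_0]
  have hsu := hu.2.sqrt
  have hsv := hv.2.sqrt
  rw [Real.sqrt_zero] at hsu hsv
  obtain ⟨C, hC⟩ := sqrt_quad_bounded hu
  obtain ⟨D, hD⟩ := sqrt_quad_bounded hv
  have hf : Tendsto (Prod.fst : ℕ × ℕ → ℕ) atTop atTop := by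
    rw [← prod_atTop_atTop_eq]; exact tendsto_fst
  have hs : Tendsto (Prod.snd : ℕ × ℕ → ℕ) atTop atTop := by
    rw [← prod_atTop_atTop_eq]; exact tendsto_snd
  have h1 := (tendsto_form_zero (v := fun p : ℕ × ℕ => v p.1) hsu ⟨D, hf.eventually hD⟩).1
  have h2 := (tendsto_form_zero (v := fun p : ℕ × ℕ => u p.2) hsv ⟨C, hs.eventually hC⟩).2
  have h3 := (h1.add h2).norm
  simp only [add_zero, norm_zero] at h3
  refine h3.congr (fun p => ?_)
  rw [dist_eq_norm]
  congr 1
  simp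

theorem Approximates.add {q : NonnegForm H} {u v : ℕ → q.domain} {f g : H}
    (hu : q.Approximates u f) (hv : q.Approximates v g) :
    q.Approximates (fun n => u n + v n) (f + g) := by
  refine ⟨by simpa using hu.1.add hv.1, ?_⟩
  have h := (hu.2.sqrt).add (hv.2.sqrt)
  simp only [Real.sqrt_zero, add_zero] at h
  have h2 := h.pow 2
  rw [zero_pow two_ne_zero] at h2
  refine squeeze_zero (fun _ => q.quad_nonneg _) (fun p => ?_) h2
  have h3 := q.sqrt_quad_add_le (u p.1 - u p.2) (v p.1 - v p.2)
  have e : u p.1 - u p.2 + (v p.1 - v p.2) = u p.1 + v p.1 - (u p.2 + v p.2) := by abel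
  rw [e] at h3
  exact (Real.sqrt_le_left (by positivity)).mp h3

theorem Approximates.smul {q : NonnegForm H} {u : ℕ → q.domain} {f : H} (c : ℂ)
    (hu : q.Approximates u f) : q.Approximates (fun n => c • u n) (c • f) := by
  refine ⟨by simpa using hu.1.const_smul c, ?_⟩
  have h := hu.2.const_mul (‖c‖ ^ 2)
  rw [mul_zero] at h
  refine h.congr (fun p => ?_)
  rw [← smul_sub, quad_smul]

theorem approximates_const (q : NonnegForm H) (f : q.domain) :
    q.Approximates (fun _ => f) (f : H) :=
  ⟨tendsto_const_nhds, by simp [quad]⟩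

/-- The domain of the closure of `q`: all `f` in `H` for which there are `u n` in the domain of `q`
with `u n → f` and `q(u n - u m) → 0`. -/
def closureDomain (q : NonnegForm H) : Submodule ℂ H where
  carrier := {f | ∃ u, q.Approximates u f}
  add_mem' := fun ⟨_, hu⟩ ⟨_, hv⟩ => ⟨_, hu.add hv⟩
  zero_mem' := ⟨_, q.approximates_const 0⟩
  smul_mem' := fun c _ ⟨_, hu⟩ => ⟨_, hu.smul c⟩

/-- An approximating sequence of an element of the domain of the closure. -/
def approxSeq (q : NonnegForm H) (f : q.closureDomain) : ℕ → q.domain := f.2.choose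

theorem approxSeq_spec (q : NonnegForm H) (f : q.closureDomain) :
    q.Approximates (q.approxSeq f) (f : H) := f.2.choose_spec

/-- The limit of `q(u n, v n)` along approximating sequences `u n → f` and `v n → g`.
By `tendsto_closureVal`, the limit exists and does not depend on the sequences
if `q` is closable. -/
def closureVal (q : NonnegForm H) (f g : q.closureDomain) : ℂ :=
  limUnder atTop (fun n => q.form (q.approxSeq f n) (q.approxSeq g n))

theorem tendsto_closureVal {q : NonnegForm H} (hq : q.IsClosable) {f g : q.closureDomain}
    {u v : ℕ → q.domain} (hu : q.Approximates u f) (hv : q.Approximates v g) :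
    Tendsto (fun n => q.form (u n) (v n)) atTop (𝓝 (q.closureVal f g)) := by
  have hf := q.approxSeq_spec f
  have hg := q.approxSeq_spec g
  have h0 : Tendsto (fun n => q.form (q.approxSeq f n) (q.approxSeq g n)) atTop
      (𝓝 (q.closureVal f g)) := (cauchySeq_form hf hg).tendsto_limUnder
  have h1 := (tendsto_form_zero (tendsto_quad_diff hq hu hf) (sqrt_quad_bounded hv)).1
  have h2 := (tendsto_form_zero (tendsto_quad_diff hq hv hg) (sqrt_quad_bounded hf)).2
  have h3 := (h0.add h1).add h2
  simp only [add_zero] at h3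
  refine h3.congr (fun n => ?_)
  simp only [map_sub, LinearMap.sub_apply]
  ring

/-- The closure of a closable non-negative form. -/
def closure (q : NonnegForm H) (hq : q.IsClosable) : NonnegForm H where
  domain := q.closureDomain
  form := LinearMap.mk₂'ₛₗ (starRingEnd ℂ) (RingHom.id ℂ) q.closureVal
    (fun f f' g => tendsto_nhds_unique
      (tendsto_closureVal hq (f := f + f') (g := g)
        ((q.approxSeq_spec f).add (q.approxSeq_spec f')) (q.approxSeq_spec g))
      (by
        simpa using (tendsto_closureVal hq (q.approxSeq_spec f) (q.approxSeq_spec g)).add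
          (tendsto_closureVal hq (q.approxSeq_spec f') (q.approxSeq_spec g))))
    (fun c f g => tendsto_nhds_unique
      (tendsto_closureVal hq (f := c • f) (g := g)
        ((q.approxSeq_spec f).smul c) (q.approxSeq_spec g))
      (by
        simpa using (tendsto_closureVal hq (q.approxSeq_spec f)
          (q.approxSeq_spec g)).const_mul (conj c)))
    (fun f g g' => tendsto_nhds_unique
      (tendsto_closureVal hq (f := f) (g := g + g')
        (q.approxSeq_spec f) ((q.approxSeq_spec g).add (q.approxSeq_spec g')))
      (by
        simpa using (tendsto_closureVal hq (q.approxSeq_spec f) (q.approxSeq_spec g)).add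
          (tendsto_closureVal hq (q.approxSeq_spec f) (q.approxSeq_spec g'))))
    (fun c f g => tendsto_nhds_unique
      (tendsto_closureVal hq (f := f) (g := c • g)
        (q.approxSeq_spec f) ((q.approxSeq_spec g).smul c))
      (by
        simpa using (tendsto_closureVal hq (q.approxSeq_spec f)
          (q.approxSeq_spec g)).const_mul c))
  conj_symm := fun f g => by
    refine tendsto_nhds_unique ?_
      (tendsto_closureVal hq (q.approxSeq_spec f) (q.approxSeq_spec g))
    refine ((Complex.continuous_conj.tendsto _).comp
      (tendsto_closureVal hq (q.approxSeq_spec g) (q.approxSeq_spec f))).congr (fun n => ?_)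
    exact q.conj_symm _ _
  nonneg := fun f => ge_of_tendsto
    ((Complex.continuous_re.tendsto _).comp
      (tendsto_closureVal hq (q.approxSeq_spec f) (q.approxSeq_spec f)))
    (Eventually.of_forall fun _ => q.nonneg _)

/-- The graph `{(f, w) : f ∈ D(q), q(f, g) = ⟨w, g⟩ for all g ∈ D(q)}` of the operator
associated with `q`. -/
def operatorGraph (q : NonnegForm H) : Submodule ℂ (H × H) where
  carrier := {p | ∃ hf : p.1 ∈ q.domain, ∀ g : q.domain, q.form ⟨p.1, hf⟩ g = inner ℂ p.2 (g : H)}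
  add_mem' := by
    rintro p p' ⟨hf, h⟩ ⟨hf', h'⟩
    refine ⟨q.domain.add_mem hf hf', fun g => ?_⟩
    have e : (⟨(p + p').1, q.domain.add_mem hf hf'⟩ : q.domain) = ⟨p.1, hf⟩ + ⟨p'.1, hf'⟩ := rfl
    rw [e, map_add, LinearMap.add_apply, h, h', Prod.snd_add, inner_add_left]
  zero_mem' := by
    refine ⟨q.domain.zero_mem, fun g => ?_⟩
    have e : (⟨(0 : H × H).1, q.domain.zero_mem⟩ : q.domain) = 0 := rfl
    rw [e, map_zero, LinearMap.zero_apply, Prod.snd_zero, inner_zero_left]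
  smul_mem' := by
    rintro c p ⟨hf, h⟩
    refine ⟨q.domain.smul_mem c hf, fun g => ?_⟩
    have e : (⟨(c • p).1, q.domain.smul_mem c hf⟩ : q.domain) = c • ⟨p.1, hf⟩ := rfl
    rw [e, map_smulₛₗ, LinearMap.smul_apply, h, Prod.smul_snd, inner_smul_left, smul_eq_mul]

/-- The operator associated with a densely defined non-negative form. -/
def operator (q : NonnegForm H) : H →ₗ.[ℂ] H := q.operatorGraph.toLinearPMap

/-- For a densely defined form, `operatorGraph` is indeed the graph of `operator`. -/
theorem graph_operator (q : NonnegForm H) (hd : Dense (q.domain : Set H)) :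
    q.operator.graph = q.operatorGraph := by
  refine Submodule.toLinearPMap_graph_eq _ ?_
  rintro ⟨f, w⟩ ⟨hf, h⟩ hf0
  have hf0' : f = 0 := hf0
  subst hf0'
  refine hd.eq_zero_of_inner_left (𝕜 := ℂ) (fun g hg => ?_)
  have e : (⟨0, hf⟩ : q.domain) = 0 := rfl
  have h' := h ⟨g, hg⟩
  simp only [e, map_zero, LinearMap.zero_apply] at h'
  exact h'.symm

end NonnegForm

/-! ### The form induced by the real part of an accretive operator -/

/-- The non-negative form `ψ ↦ Re ⟨ψ, A ψ⟩` with domain `D(A)`; by polarization its sesquilinear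
form is `(f, g) ↦ (⟨f, A g⟩ + ⟨A f, g⟩) / 2`. -/
def reForm (A : H →ₗ.[ℂ] H) (hA : IsAccretive A) : NonnegForm H where
  domain := A.domain
  form := LinearMap.mk₂'ₛₗ (starRingEnd ℂ) (RingHom.id ℂ)
    (fun f g => (inner ℂ (f : H) (A g) + inner ℂ (A f) (g : H)) / 2)
    (fun f f' g => by simp [LinearPMap.map_add]; ring)
    (fun c f g => by simp [LinearPMap.map_smul]; ring)
    (fun f g g' => by simp [LinearPMap.map_add]; ring)
    (fun c f g => by simp [LinearPMap.map_smul]; ring)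
  conj_symm := fun f g => by
    simp [add_comm, Complex.conj_ofNat]
  nonneg := fun f => by
    have h := hA.2 f
    have h2 : (inner ℂ (A f) (f : H)).re = (inner ℂ (f : H) (A f)).re := inner_re_symm (𝕜 := ℂ) _ _
    have e : ((inner ℂ (f : H) (A f) + inner ℂ (A f) (f : H)) / 2 : ℂ).re
        = (inner ℂ (f : H) (A f)).re := by
      rw [Complex.div_ofNat_re, Complex.add_re, h2]; ring
    rw [LinearMap.mk₂'ₛₗ_apply, e]
    exact h

theorem reForm_quad (A : H →ₗ.[ℂ] H) (hA : IsAccretive A) (ψ : A.domain) :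
    (reForm A hA).quad ψ = (inner ℂ (ψ : H) (A ψ)).re := by
  have h2 : (inner ℂ (A ψ) (ψ : H)).re = (inner ℂ (ψ : H) (A ψ)).re := inner_re_symm (𝕜 := ℂ) _ _
  change ((inner ℂ (ψ : H) (A ψ) + inner ℂ (A ψ) (ψ : H)) / 2 : ℂ).re = _
  rw [Complex.div_ofNat_re, Complex.add_re, h2]; ring

/-- The operator associated with the closure of the form `ψ ↦ Re ⟨ψ, A ψ⟩`. -/
def realPartOperator (A : H →ₗ.[ℂ] H) (hA : IsAccretive A) (hcl : (reForm A hA).IsClosable) :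
    H →ₗ.[ℂ] H :=
  ((reForm A hA).closure hcl).operator

end RealPartForm

end

namespace RealPartForm

variable {H : Type*} [NormedAddCommGroup H] [InnerProductSpace ℂ H]

/-! For `f ∈ D(V)` and `g ∈ D(A_D)`, the inclusion `A_+ ⊂ A_D` gives `⟨A_D f, g⟩ = ⟨A_+ f, g⟩`, and
`A_D ⊂ A_-^*` gives `⟨f, A_D g⟩ = ⟨A_- f, g⟩`. In the average the terms in `S` cancel and `⟨V f, g⟩`
remains (`reForm_form_eq_inner`); this identity passes to the closed form, so `V ⊂ V_D`
(`le_realPartOperator`). In particular `V_D` is densely defined. Its symmetry and non-negativity are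
inherited from the form.

Selfadjointness then reduces to surjectivity of `V_D + 1` (`isSelfAdjoint_of_surjective_add_one`).
Riesz representation is applied in the abstract completion of `D(A_D)` for `q(f, g) + ⟨f, g⟩`, so
the domain of the closed form need not be shown to be complete. The representing vector is a limit
of `u n ∈ D(A_D)`, these converge in `H` to some `f`, and `mem_operatorGraph_closure` turns the
limiting identity into `V_D f + f = h`. -/

/-- A densely defined symmetric operator `T` with `T + 1` surjective is selfadjoint. -/
theorem isSelfAdjoint_of_surjective_add_one [CompleteSpace H] {T : H →ₗ.[ℂ] H}
    (hT : IsSymmetricOp T) (hs : ∀ h : H, ∃ f : T.domain, T f + (f : H) = h) :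
    IsSelfAdjoint T := by
  obtain ⟨hd, hsym⟩ := hT
  rw [LinearPMap.isSelfAdjoint_def]
  refine le_antisymm ?_ (hsym.le_adjoint hd)
  refine LinearPMap.le_of_le_graph ?_
  rintro ⟨y, w⟩ hyw
  rw [LinearPMap.mem_graph_iff] at hyw
  obtain ⟨y, rfl, rfl⟩ := hyw
  obtain ⟨x, hx⟩ := hs (T.adjoint y + (y : H))
  -- Injectivity of `T* + 1`: every vector has the form `T z + z`, and `⟨y, T z + z⟩ = ⟨T* y + y, z⟩
  -- = ⟨T x + x, z⟩ = ⟨x, T z + z⟩`.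
  have hyx : (y : H) = x := by
    refine ext_inner_right ℂ fun v => ?_
    obtain ⟨z, rfl⟩ := hs v
    have h1 : inner ℂ (T.adjoint y) (z : H) = inner ℂ (y : H) (T z) :=
      LinearPMap.adjoint_isFormalAdjoint hd y z
    have h2 : inner ℂ (T x) (z : H) = inner ℂ (x : H) (T z) := hsym x z
    rw [inner_add_right, inner_add_right, ← h1, ← h2, ← inner_add_left, ← inner_add_left, hx]
  have hw : T.adjoint y = T x := by
    rw [hyx] at hx
    exact (add_right_cancel hx).symm
  rw [LinearPMap.mem_graph_iff]
  exact ⟨x, hyx.symm, hw.symm⟩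

/-! ### The form norm and Riesz representation in its completion -/

namespace NonnegForm

/-- The domain of `q`, to be equipped with the inner product `q(f, g) + ⟨f, g⟩`. -/
def FormSpace (q : NonnegForm H) : Type _ := q.domain

namespace FormSpace

variable (q : NonnegForm H)

instance : AddCommGroup q.FormSpace := inferInstanceAs (AddCommGroup q.domain)

instance : Module ℂ q.FormSpace := inferInstanceAs (Module ℂ q.domain)

/-- The identity map from the domain of `q` to the form space. -/
def equiv : q.domain ≃ₗ[ℂ] q.FormSpace := LinearEquiv.refl ℂ q.domain

/-- The inner product `q(f, g) + ⟨f, g⟩`. -/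
@[reducible]
noncomputable def core : InnerProductSpace.Core ℂ q.FormSpace where
  inner f g := q.form ((equiv q).symm f) ((equiv q).symm g)
    + inner ℂ ((equiv q).symm f : H) ((equiv q).symm g : H)
  conj_inner_symm f g := by
    rw [map_add, q.conj_symm, inner_conj_symm]
  re_inner_nonneg f := by
    rw [map_add]
    exact add_nonneg (q.nonneg _) inner_self_nonneg
  add_left f g k := by
    simp only [map_add, LinearMap.add_apply, Submodule.coe_add, inner_add_left]
    ring
  smul_left f g c := by
    simp only [map_smul, map_smulₛₗ, LinearMap.smul_apply, Submodule.coe_smul, inner_smul_left,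
      smul_eq_mul]
    ring
  definite f hf := by
    have h1 : q.quad ((equiv q).symm f) + ‖((equiv q).symm f : H)‖ ^ 2 = 0 := by
      rw [← inner_self_eq_norm_sq (𝕜 := ℂ)]
      exact congrArg Complex.re hf
    have h2 := q.quad_nonneg ((equiv q).symm f)
    have h3 : ‖((equiv q).symm f : H)‖ = 0 := by
      refine pow_eq_zero_iff two_ne_zero |>.mp ?_
      nlinarith [sq_nonneg ‖((equiv q).symm f : H)‖]
    have h4 : (equiv q).symm f = 0 := Subtype.ext (norm_eq_zero.mp h3)
    simpa using h4

noncomputable instance : NormedAddCommGroup q.FormSpace := (core q).toNormedAddCommGroup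

noncomputable instance : InnerProductSpace ℂ q.FormSpace := InnerProductSpace.ofCore (core q).toCore

theorem inner_equiv (f g : q.domain) :
    inner ℂ (equiv q f) (equiv q g) = q.form f g + inner ℂ (f : H) (g : H) := rfl

theorem norm_equiv_sq (f : q.domain) : ‖equiv q f‖ ^ 2 = q.quad f + ‖(f : H)‖ ^ 2 := by
  rw [← inner_self_eq_norm_sq (𝕜 := ℂ), inner_equiv, map_add, inner_self_eq_norm_sq (𝕜 := ℂ)]
  rfl

theorem norm_le_norm_equiv (f : q.domain) : ‖(f : H)‖ ≤ ‖equiv q f‖ := by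
  refine le_of_sq_le_sq ?_ (norm_nonneg _)
  rw [norm_equiv_sq]
  linarith [q.quad_nonneg f]

/-- The contractive embedding of the form space. -/
noncomputable def incl : q.FormSpace →L[ℂ] H :=
  LinearMap.mkContinuous (q.domain.subtype ∘ₗ (equiv q).symm.toLinearMap) 1 fun f => by
    rw [one_mul]
    exact norm_le_norm_equiv q ((equiv q).symm f)

/-- Cauchy sequences for the norm of the form space approximate their limits in `H`. -/
theorem exists_approximates [CompleteSpace H] {u : ℕ → q.domain}
    (hu : CauchySeq fun n => equiv q (u n)) : ∃ f : H, q.Approximates u f := by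
  obtain ⟨f, hf⟩ := cauchySeq_tendsto_of_complete
    ((incl q).uniformContinuous.comp_cauchySeq hu)
  refine ⟨f, hf, ?_⟩
  rw [cauchySeq_iff_tendsto_dist_atTop_0] at hu
  have h := hu.pow 2
  rw [zero_pow two_ne_zero] at h
  refine squeeze_zero (fun _ => q.quad_nonneg _) (fun p => ?_) h
  -- The squared form norm is `q` plus the squared norm of `H`, hence dominates `q`.
  rw [dist_eq_norm, ← map_sub, norm_equiv_sq]
  exact le_add_of_nonneg_right (sq_nonneg _)

/-- Riesz representation in the completion of the form space. -/
theorem exists_cauchySeq_tendsto (h : H) : ∃ u : ℕ → q.domain,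
    (CauchySeq fun n => equiv q (u n)) ∧ ∀ g : q.domain,
      Tendsto (fun n => q.form (u n) g + inner ℂ (u n : H) (g : H)) atTop
        (𝓝 (inner ℂ h (g : H))) := by
  let ι : q.FormSpace →L[ℂ] UniformSpace.Completion q.FormSpace :=
    UniformSpace.Completion.toComplL
  have hdense : DenseRange ι := UniformSpace.Completion.denseRange_coe
  have hind : IsUniformInducing ι := UniformSpace.Completion.isUniformInducing_coe _
  -- The functional `g ↦ ⟨h, g⟩` is bounded for the form norm because the embedding into `H` is
  -- contractive; hence it extends to the completion.
  let L : q.FormSpace →L[ℂ] ℂ := innerSL ℂ h ∘L incl q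
  let F := (InnerProductSpace.toDual ℂ (UniformSpace.Completion q.FormSpace)).symm (L.extend ι)
  obtain ⟨v, hv, hvF⟩ := mem_closure_iff_seq_limit.mp (hdense F)
  choose u hu using hv
  obtain rfl : (fun n => ι (u n)) = v := funext hu
  refine ⟨fun n => (equiv q).symm (u n), ?_, fun g => ?_⟩
  · have hc : CauchySeq fun n => ι (u n) := hvF.cauchySeq
    exact hind.cauchy_map_iff.mp (by rw [Filter.map_map]; exact hc)
  · have h1 : inner ℂ F (ι (equiv q g)) = inner ℂ h (g : H) := by
      rw [InnerProductSpace.toDual_symm_apply, ContinuousLinearMap.extend_eq _ hdense hind]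
      rfl
    rw [← h1]
    refine (hvF.inner tendsto_const_nhds).congr fun n => ?_
    exact UniformSpace.Completion.inner_coe _ _

end FormSpace

/-! ### The closed form and its operator -/

theorem domain_le_closureDomain (q : NonnegForm H) : q.domain ≤ q.closureDomain :=
  fun f hf => ⟨_, q.approximates_const ⟨f, hf⟩⟩

/-- Membership in the graph of the operator of the closure may be tested on the domain of `q`. -/
theorem mem_operatorGraph_closure {q : NonnegForm H} (hq : q.IsClosable) {u : ℕ → q.domain}
    {f w : H} (hu : q.Approximates u f)
    (h : ∀ g : q.domain, Tendsto (fun n => q.form (u n) g) atTop (𝓝 (inner ℂ w (g : H)))) :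
    (f, w) ∈ (q.closure hq).operatorGraph := by
  have hf : f ∈ q.closureDomain := ⟨u, hu⟩
  refine ⟨hf, fun g => ?_⟩
  have key : ∀ g : q.domain,
      q.closureVal ⟨f, hf⟩ ⟨g, q.domain_le_closureDomain g.2⟩ = inner ℂ w (g : H) := fun g =>
    tendsto_nhds_unique
      (tendsto_closureVal hq (f := ⟨f, hf⟩) (g := ⟨g, q.domain_le_closureDomain g.2⟩) hu
        (q.approximates_const g)) (h g)
  obtain ⟨v, hv⟩ : ∃ v, q.Approximates v (g : H) := g.2
  have h1 : Tendsto (fun n => (q.closure hq).form ⟨f, hf⟩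
      ⟨v n, q.domain_le_closureDomain (v n).2⟩) atTop (𝓝 (inner ℂ w (g : H))) := by
    refine (tendsto_const_nhds.inner hv.1).congr fun n => ?_
    exact (key (v n)).symm
  let v' : ℕ → (q.closure hq).domain := fun n => ⟨v n, q.domain_le_closureDomain (v n).2⟩
  -- The original domain is a core: for fixed `n`, the closed form at `v n - g` is the limit over
  -- `m` of `q (v n - v m)`, which is small for large `n` by the Cauchy condition.
  have h2 : Tendsto (fun n => √((q.closure hq).quad (v' n - g))) atTop (𝓝 0) := by
    have h3 := hv.2.sqrt
    rw [Real.sqrt_zero, ← prod_atTop_atTop_eq] at h3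
    rw [Metric.tendsto_atTop]
    intro ε hε
    have h4 := h3.eventually (gt_mem_nhds (half_pos hε))
    rw [prod_atTop_atTop_eq, eventually_atTop] at h4
    obtain ⟨⟨a, b⟩, hab⟩ := h4
    refine ⟨a, fun n hn => ?_⟩
    have h5 : Tendsto (fun m => √(q.quad (v n - v m))) atTop 
        (𝓝 (√((q.closure hq).quad (v' n - g)))) := by
      have h6 : q.Approximates (fun m => v n - v m)
          ((v' n - g : (q.closure hq).domain) : H) := by
        have := (q.approximates_const (v n)).add (hv.smul (-1))
        simpa [v', sub_eq_add_neg] using this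
      exact ((Complex.continuous_re.tendsto _).comp (tendsto_closureVal hq h6 h6)).sqrt
    have h7 := le_of_tendsto h5 ((eventually_ge_atTop b).mono fun m hm =>
      (hab (n, m) ⟨hn, hm⟩).le)
    rw [Real.dist_0_eq_abs, abs_of_nonneg (Real.sqrt_nonneg _)]
    linarith
  -- Cauchy–Schwarz with the fixed vector `f` carries this convergence over to the sesquilinear
  -- form.
  have h8 := (tendsto_form_zero (v := fun _ => (⟨f, hf⟩ : (q.closure hq).domain)) h2
    ⟨_, Eventually.of_forall fun _ => le_rfl⟩).2
  have h9 := (tendsto_const_nhds (x := (q.closure hq).form ⟨f, hf⟩ g)).add h8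
  rw [add_zero] at h9
  refine tendsto_nhds_unique (h9.congr fun n => ?_) h1
  rw [map_sub]
  exact add_sub_cancel _ _

theorem exists_form_eq_inner_operator {q : NonnegForm H} (hd : Dense (q.domain : Set H))
    (f : q.operator.domain) : ∃ hf : (f : H) ∈ q.domain, ∀ g : q.domain,
      q.form ⟨f, hf⟩ g = inner ℂ (q.operator f) (g : H) := by
  have h := q.operator.mem_graph f
  rw [q.graph_operator hd] at h
  exact h

theorem isFormalAdjoint_operator {q : NonnegForm H} (hd : Dense (q.domain : Set H)) :
    q.operator.IsFormalAdjoint q.operator := by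
  intro f g
  obtain ⟨hf, h1⟩ := exists_form_eq_inner_operator hd f
  obtain ⟨hg, h2⟩ := exists_form_eq_inner_operator hd g
  have h3 := h1 ⟨g, hg⟩
  have h4 := h2 ⟨f, hf⟩
  rw [← q.conj_symm, h4, inner_conj_symm] at h3
  exact h3.symm

theorem isBoundedBelowBy_operator {q : NonnegForm H} (hd : Dense (q.domain : Set H)) :
    IsBoundedBelowBy q.operator 0 := by
  intro f
  obtain ⟨hf, h⟩ := exists_form_eq_inner_operator hd f
  have h1 : 0 ≤ (inner ℂ (q.operator f) (f : H)).re := by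
    have h2 := q.nonneg ⟨f, hf⟩
    rwa [h ⟨f, hf⟩] at h2
  rw [zero_mul]
  exact h1.trans_eq (inner_re_symm (𝕜 := ℂ) _ _)

theorem dense_closure_domain {q : NonnegForm H} (hq : q.IsClosable)
    (hd : Dense (q.domain : Set H)) : Dense ((q.closure hq).domain : Set H) :=
  hd.mono q.domain_le_closureDomain

/-- The Riesz sequence satisfies `q(u n, g) + ⟨u n, g⟩ → ⟨h, g⟩` and `u n → f` in `H`. Subtracting
leaves `q(u n, g) → ⟨h - f, g⟩`, so `h - f` is the value of the operator at `f`. -/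
theorem surjective_operator_closure_add_one [CompleteSpace H] {q : NonnegForm H}
    (hq : q.IsClosable) (hd : Dense (q.domain : Set H)) (h : H) :
    ∃ f : (q.closure hq).operator.domain, (q.closure hq).operator f + (f : H) = h := by
  obtain ⟨u, hc, hu⟩ := FormSpace.exists_cauchySeq_tendsto q h
  obtain ⟨f, hf⟩ := FormSpace.exists_approximates q hc
  have hmem : (f, h - f) ∈ (q.closure hq).operator.graph := by
    rw [graph_operator _ (dense_closure_domain hq hd)]
    refine mem_operatorGraph_closure hq hf fun g => ?_
    rw [inner_sub_left]
    refine ((hu g).sub (hf.1.inner tendsto_const_nhds)).congr fun n => ?_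
    ring
  rw [LinearPMap.mem_graph_iff] at hmem
  obtain ⟨x, hx, hTx⟩ := hmem
  exact ⟨x, by rw [hTx, hx]; simp⟩

end NonnegForm

/-! ### The operator of the real part extends `V` -/

/-- If `f ∈ D(S) = D(V)`, then `(⟨f, A g⟩ + ⟨A f, g⟩) / 2 = ⟨V f, g⟩` for `g ∈ D(A)`. -/
theorem reForm_form_eq_inner [CompleteSpace H] {S V A : H →ₗ.[ℂ] H}
    (hdom : S.domain = V.domain) (hd : Dense ((opMinus S V).domain : Set H))
    (hproper : IsProperExtension (opPlus S V) (opMinus S V) A) (hA : IsAccretive A)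
    (f : V.domain) : ∃ hf : (f : H) ∈ A.domain, ∀ g : A.domain,
      (reForm A hA).form ⟨f, hf⟩ g = inner ℂ (V f) (g : H) := by
  have hfS : (f : H) ∈ S.domain := hdom.ge f.2
  have hfP : (f : H) ∈ (opPlus S V).domain := ⟨hfS, f.2⟩
  have hfM : (f : H) ∈ (opMinus S V).domain := ⟨hfS, f.2⟩
  refine ⟨hproper.1.1 hfP, fun g => ?_⟩
  have hAf : A ⟨f, hproper.1.1 hfP⟩ = Complex.I • S ⟨f, hfS⟩ + V f :=
    (hproper.1.2 (x := ⟨f, hfP⟩) (y := ⟨f, hproper.1.1 hfP⟩) rfl).symm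
  -- Since `A g = A_-^* g`, the operator moves to the left slot as `A_-`, which is defined at `f`.
  have hAg : inner ℂ (f : H) (A g) = inner ℂ ((-Complex.I) • S ⟨f, hfS⟩ + V f) (g : H) := by
    have h1 : A g = (opMinus S V).adjoint ⟨g, hproper.2.1 g.2⟩ :=
      hproper.2.2 (x := g) (y := ⟨g, hproper.2.1 g.2⟩) rfl
    rw [h1, ← inner_conj_symm,
      LinearPMap.adjoint_isFormalAdjoint hd ⟨g, hproper.2.1 g.2⟩ ⟨f, hfM⟩, inner_conj_symm]
    rfl
  change (inner ℂ (f : H) (A g) + inner ℂ (A ⟨f, hproper.1.1 hfP⟩) (g : H)) / 2 = _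
  rw [hAg, hAf, ← inner_add_left, neg_smul]
  have e : -(Complex.I • S ⟨f, hfS⟩) + V f + (Complex.I • S ⟨f, hfS⟩ + V f)
      = (2 : ℂ) • V f := by
    rw [two_smul]; abel
  rw [e, inner_smul_left, Complex.conj_ofNat]
  ring

theorem le_realPartOperator [CompleteSpace H] {S V A : H →ₗ.[ℂ] H}
    (hdom : S.domain = V.domain) (hd : Dense ((opMinus S V).domain : Set H))
    (hproper : IsProperExtension (opPlus S V) (opMinus S V) A) (hA : IsAccretive A)
    (hcl : (reForm A hA).IsClosable) : V ≤ realPartOperator A hA hcl := by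
  refine LinearPMap.le_of_le_graph ?_
  rintro ⟨f, w⟩ hfw
  rw [LinearPMap.mem_graph_iff] at hfw
  obtain ⟨f, rfl, rfl⟩ := hfw
  rw [realPartOperator, NonnegForm.graph_operator _ (NonnegForm.dense_closure_domain hcl hA.1)]
  obtain ⟨hf, h⟩ := reForm_form_eq_inner hdom hd hproper hA f
  -- Since `f` already lies in `D(A)`, the constant sequence approximates it.
  refine NonnegForm.mem_operatorGraph_closure hcl
    ((reForm A hA).approximates_const ⟨f, hf⟩) fun g => ?_
  rw [h g]
  exact tendsto_const_nhds

end RealPartForm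

theorem mainTheorem9 {H : Type*} [NormedAddCommGroup H] [InnerProductSpace ℂ H] [CompleteSpace H]
    (S V : H →ₗ.[ℂ] H) (hdom : S.domain = V.domain)
    (hS : RealPartForm.IsSymmetricOp S) (hV : RealPartForm.IsSymmetricOp V)
    (ε : ℝ) (hε : 0 < ε) (hVε : RealPartForm.IsBoundedBelowBy V ε)
    (hplus : RealPartForm.IsSectorial (RealPartForm.opPlus S V))
    (hminus : RealPartForm.IsSectorial (RealPartForm.opMinus S V))
    (A : H →ₗ.[ℂ] H)
    (hproper : RealPartForm.IsProperExtension
      (RealPartForm.opPlus S V) (RealPartForm.opMinus S V) A)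
    (hA : RealPartForm.IsMaximallyAccretive A)
    (hcl : (RealPartForm.reForm A hA.1).IsClosable) :
    IsSelfAdjoint (RealPartForm.realPartOperator A hA.1 hcl) ∧
      RealPartForm.IsBoundedBelowBy (RealPartForm.realPartOperator A hA.1 hcl) 0 ∧
      V ≤ RealPartForm.realPartOperator A hA.1 hcl := by
  have hVle := RealPartForm.le_realPartOperator hdom hminus.1.1 hproper hA.1 hcl
  have hd := RealPartForm.NonnegForm.dense_closure_domain hcl hA.1.1
  refine ⟨?_, RealPartForm.NonnegForm.isBoundedBelowBy_operator hd, hVle⟩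
  exact RealPartForm.isSelfAdjoint_of_surjective_add_one
    -- Density of the domain comes from the dense subspace `D(V)` that it contains.
    ⟨hV.1.mono hVle.1, RealPartForm.NonnegForm.isFormalAdjoint_operator hd⟩
    (RealPartForm.NonnegForm.surjective_operator_closure_add_one hcl hA.1.1)
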